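/- Let $d, q \in \mathbb{N}$ and let $U \subseteq \mathbb{R}^d$ be a Borel measurable set (in particular, any domain), with Lebesgue measure. Let $L^2(U;\mathbb{R}^q)$ be the Hilbert space of square-integrable vector fields on $U$ with inner product $(\mathbf{u},\mathbf{v}) = \int_U \mathbf{u}^{T}\mathbf{v}\,d\mathbf{x}$, and let $L^2(U\times U;\mathbb{R}^{q\times q})$ be the Hilbert space of square-integrable matrix-valued functions on $U \times U$ with inner product $$(\mathbf{A},\mathbf{B}) = \int_U\int_U \sum_{i,j=1}^{q} A_{ij}(\mathbf{x},\mathbf{y})\,B_{ij}(\mathbf{x},\mathbf{y})\,d\mathbf{x}\,d\mathbf{y}.$$ Let $L^2(U;\mathbb{R}^q)\otimes L^2(U;\mathbb{R}^q)$ be the Hilbert tensor product, that is, the completion of the algebraic tensor product over $\mathbb{R}$ for the inner product determined by $(\mathbf{a}\otimes \mathbf{b}, \mathbf{c}\otimes \mathbf{d}) = (\mathbf{a},\mathbf{c})(\mathbf{b},\mathbf{d})$. Then there is an isometric linear isomorphism of $L^2(U;\mathbb{R}^q)\otimes L^2(U;\mathbb{R}^q)$ onto $L^2(U\times U;\mathbb{R}^{q\times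 q})$ which, for all $\mathbf{v},\mathbf{w}\in L^2(U;\mathbb{R}^q)$, sends $\mathbf{v}\otimes \mathbf{w}$ to the function $(\mathbf{x},\mathbf{y})\mapsto \mathbf{v}(\mathbf{x})\,\mathbf{w}(\mathbf{y})^{T}$ (almost everywhere). In particular, for every complete orthonormal basis $\{\mathbf{v}_k\}_{k}$ of $L^2(U;\mathbb{R}^q)$ it sends $\mathbf{v}_k\otimes \mathbf{v}_l$ to $\mathbf{v}_k(\mathbf{x})\mathbf{v}_l(\mathbf{y})^{T}$ for all $k,l$. -/

import Mathlib

open MeasureTheory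
open scoped TensorProduct Matrix Matrix.Norms.Frobenius

/-- The Frobenius inner product `(A, B) = 1ᵀ (A ⊙ B) 1 = ∑ i j, A i j * B i j` on real `q × q`
matrices; its norm is the Frobenius norm. The inner product that Mathlib puts on an `L²` space of
matrix-valued functions is then `∫ 1ᵀ (A ⊙ B) 1`. -/
noncomputable instance frobeniusInnerProductSpace (q : ℕ) :
    InnerProductSpace ℝ (Matrix (Fin q) (Fin q) ℝ) where
  inner A B := (1 : Fin q → ℝ) ⬝ᵥ ((A ⊙ B) *ᵥ (1 : Fin q → ℝ))
  norm_sq_eq_re_inner A := by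
    rw [Matrix.frobenius_norm_def, ← Real.sqrt_eq_rpow, Real.sq_sqrt (by positivity)]
    simp [dotProduct, Matrix.mulVec, pow_two]
  conj_inner_symm A B := by
    simp [dotProduct, Matrix.mulVec, mul_comm]
  add_left A B C := by
    simp [dotProduct, Matrix.mulVec, add_mul, Finset.sum_add_distrib]
  smul_left A B r := by
    simp [dotProduct, Matrix.mulVec, mul_assoc, Finset.mul_sum]

/-- `L²(U; ℝ^q)` for `U ⊆ ℝ^d`, with Lebesgue measure on `U`. -/
abbrev L2Vec {d : ℕ} (U : Set (EuclideanSpace ℝ (Fin d))) (q : ℕ) : Type :=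
  Lp (EuclideanSpace ℝ (Fin q)) 2 (volume.restrict U)

/-- `L²(U × U; ℝ^{q × q})` for `U ⊆ ℝ^d`, with Lebesgue measure on `U × U` and the Frobenius
inner product on matrices. -/
abbrev L2Mat {d : ℕ} (U : Set (EuclideanSpace ℝ (Fin d))) (q : ℕ) : Type :=
  Lp (Matrix (Fin q) (Fin q) ℝ) 2 (volume.restrict (U ×ˢ U))

/-- The Hilbert tensor product of two real inner product spaces: the completion of the algebraic
tensor product for the inner product `⟪a ⊗ b, c ⊗ d⟫ = ⟪a, c⟫ * ⟪b, d⟫`. -/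
abbrev HilbertTensor (H K : Type*) [NormedAddCommGroup H] [InnerProductSpace ℝ H]
    [NormedAddCommGroup K] [InnerProductSpace ℝ K] : Type _ :=
  UniformSpace.Completion (H ⊗[ℝ] K)

/-- The elementary tensor `v ⊗ w` as an element of the Hilbert tensor product. -/
noncomputable def hilbertTmul {H K : Type*} [NormedAddCommGroup H] [InnerProductSpace ℝ H]
    [NormedAddCommGroup K] [InnerProductSpace ℝ K] (v : H) (w : K) : HilbertTensor H K :=
  ((v ⊗ₜ[ℝ] w : H ⊗[ℝ] K) : UniformSpace.Completion (H ⊗[ℝ] K))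

/-
Call a map `B : H → K → L` between real inner product spaces a Hilbert tensor map if it satisfies
`⟪B x y, B x' y'⟫ = ⟪x, x'⟫ * ⟪y, y'⟫` and only `0` is orthogonal to its range. Such a map is
automatically bilinear, and if `L` is complete it identifies the Hilbert tensor product of `H` and
`K` with `L`. The outer product `(a, b) ↦ a bᵀ` is a Hilbert tensor map, and the property passes
from `B` to `(v, w) ↦ ((x, y) ↦ B (v x) (w y))` on `L²` spaces: Fubini gives the inner products, and
testing against indicators of rectangles shows that a function orthogonal to the range has integral
zero over every rectangle, hence vanishes almost everywhere.
-/

/-- The defining properties of the map `(x, y) ↦ x ⊗ y` into a Hilbert tensor product of `H` and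
`K`. Bilinearity is a consequence, so it is not part of the definition; nor is completeness of
`L`. -/
structure IsHilbertTensorMap {H K L : Type*} [NormedAddCommGroup H] [InnerProductSpace ℝ H]
    [NormedAddCommGroup K] [InnerProductSpace ℝ K] [NormedAddCommGroup L] [InnerProductSpace ℝ L]
    (B : H → K → L) : Prop where
  inner_map_map : ∀ x x' y y', inner ℝ (B x y) (B x' y') = inner ℝ x x' * inner ℝ y y'
  eq_zero_of_forall_inner_eq_zero : ∀ z, (∀ x y, inner ℝ (B x y) z = 0) → z = 0

namespace IsHilbertTensorMap

variable {H K L : Type*} [NormedAddCommGroup H] [InnerProductSpace ℝ H]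
  [NormedAddCommGroup K] [InnerProductSpace ℝ K] [NormedAddCommGroup L] [InnerProductSpace ℝ L]
  {B : H → K → L}

theorem ext_inner (hB : IsHilbertTensorMap B) {z z' : L}
    (h : ∀ x y, inner ℝ (B x y) z = inner ℝ (B x y) z') : z = z' :=
  sub_eq_zero.1 <| hB.eq_zero_of_forall_inner_eq_zero _ fun x y => by
    rw [inner_sub_right, h, sub_self]

/-- A Hilbert tensor map as a bilinear map, so that it can be lifted to the algebraic tensor
product. -/
def toBilin (hB : IsHilbertTensorMap B) : H →ₗ[ℝ] K →ₗ[ℝ] L :=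
  LinearMap.mk₂ ℝ B
    (fun _ _ _ => hB.ext_inner fun _ _ => by
      simp only [inner_add_right, hB.inner_map_map, add_mul])
    (fun _ _ _ => hB.ext_inner fun _ _ => by
      simp only [real_inner_smul_right, hB.inner_map_map, mul_assoc])
    (fun _ _ _ => hB.ext_inner fun _ _ => by
      simp only [inner_add_right, hB.inner_map_map, mul_add])
    (fun _ _ _ => hB.ext_inner fun _ _ => by
      simp only [real_inner_smul_right, hB.inner_map_map, mul_left_comm])

theorem toBilin_apply (hB : IsHilbertTensorMap B) (x : H) (y : K) : hB.toBilin x y = B x y :=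
  rfl

theorem map_zero_left (hB : IsHilbertTensorMap B) (y : K) : B 0 y = 0 :=
  hB.toBilin.map_zero₂ y

theorem map_zero_right (hB : IsHilbertTensorMap B) (x : H) : B x 0 = 0 :=
  (hB.toBilin x).map_zero

theorem norm_map (hB : IsHilbertTensorMap B) (x : H) (y : K) : ‖B x y‖ = ‖x‖ * ‖y‖ := by
  rw [← sq_eq_sq₀ (norm_nonneg _) (by positivity), mul_pow]
  simp only [← real_inner_self_eq_norm_sq, hB.inner_map_map]

theorem continuous_uncurry (hB : IsHilbertTensorMap B) :
    Continuous fun p : H × K => B p.1 p.2 :=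
  (hB.toBilin.mkContinuous₂ 1 fun x y => by
    rw [one_mul, toBilin_apply, hB.norm_map]).continuous₂

theorem inner_lift_toBilin (hB : IsHilbertTensorMap B) (s t : H ⊗[ℝ] K) :
    inner ℝ (TensorProduct.lift hB.toBilin s) (TensorProduct.lift hB.toBilin t) =
      inner ℝ s t := by
  induction s with
  | zero => simp only [map_zero, inner_zero_left]
  | add s₁ s₂ h₁ h₂ => simp only [map_add, inner_add_left, h₁, h₂]
  | tmul x y =>
    induction t with
    | zero => simp only [map_zero, inner_zero_right]
    | add t₁ t₂ h₁ h₂ => simp only [map_add, inner_add_right, h₁, h₂]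
    | tmul x' y' =>
      simp only [TensorProduct.lift.tmul, toBilin_apply, hB.inner_map_map,
        TensorProduct.inner_tmul]

/-- The isometric embedding of the algebraic tensor product induced by a Hilbert tensor map. -/
noncomputable def liftIsometry (hB : IsHilbertTensorMap B) : H ⊗[ℝ] K →ₗᵢ[ℝ] L :=
  (TensorProduct.lift hB.toBilin).isometryOfInner hB.inner_lift_toBilin

theorem liftIsometry_tmul (hB : IsHilbertTensorMap B) (x : H) (y : K) :
    hB.liftIsometry (x ⊗ₜ[ℝ] y) = B x y :=
  TensorProduct.lift.tmul x y

theorem denseRange_liftIsometry [CompleteSpace L] (hB : IsHilbertTensorMap B) :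
    DenseRange hB.liftIsometry := by
  suffices (LinearMap.range hB.liftIsometry.toLinearMap).topologicalClosure = ⊤ from
    Submodule.dense_iff_topologicalClosure_eq_top.2 this
  rw [Submodule.topologicalClosure_eq_top_iff, Submodule.eq_bot_iff]
  intro z hz
  refine hB.eq_zero_of_forall_inner_eq_zero z fun x y => ?_
  rw [← hB.liftIsometry_tmul]
  exact (Submodule.mem_orthogonal _ _).1 hz _ ⟨_, rfl⟩

/-- The isometric isomorphism from the Hilbert tensor product onto the target of a Hilbert tensor
map. -/
noncomputable def hilbertTensorEquiv [CompleteSpace L] (hB : IsHilbertTensorMap B) :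
    HilbertTensor H K ≃ₗᵢ[ℝ] L :=
  (LinearEquiv.refl ℝ (H ⊗[ℝ] K)).extendOfIsometry
    (UniformSpace.Completion.toComplₗᵢ (𝕜 := ℝ)).toLinearMap hB.liftIsometry.toLinearMap
    UniformSpace.Completion.denseRange_coe hB.denseRange_liftIsometry fun t =>
      (hB.liftIsometry.norm_map t).trans (UniformSpace.Completion.norm_coe t).symm

theorem hilbertTensorEquiv_hilbertTmul [CompleteSpace L] (hB : IsHilbertTensorMap B) (x : H)
    (y : K) : hB.hilbertTensorEquiv (hilbertTmul x y) = B x y :=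
  (LinearEquiv.extendOfIsometry_eq (LinearEquiv.refl ℝ (H ⊗[ℝ] K)) _ _ _ _ _ _).trans
    (hB.liftIsometry_tmul x y)

end IsHilbertTensorMap

section OuterProduct

variable {q : ℕ}

theorem frobenius_inner_eq_sum (A B : Matrix (Fin q) (Fin q) ℝ) :
    inner ℝ A B = ∑ i, ∑ j, A i j * B i j := by
  change (1 : Fin q → ℝ) ⬝ᵥ ((A ⊙ B) *ᵥ (1 : Fin q → ℝ)) = _
  simp only [dotProduct, Matrix.mulVec, Matrix.hadamard_apply, Pi.one_apply, one_mul, mul_one]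

theorem frobenius_inner_vecMulVec_single (A : Matrix (Fin q) (Fin q) ℝ) (i j : Fin q) :
    inner ℝ (Matrix.vecMulVec (EuclideanSpace.single i (1 : ℝ))
      (EuclideanSpace.single j (1 : ℝ))) A = A i j := by
  simp [frobenius_inner_eq_sum, Matrix.vecMulVec_apply, Pi.single_apply]

theorem isHilbertTensorMap_vecMulVec :
    IsHilbertTensorMap fun a b : EuclideanSpace ℝ (Fin q) => Matrix.vecMulVec a b where
  inner_map_map a a' b b' := by
    simp only [frobenius_inner_eq_sum, Matrix.vecMulVec_apply, PiLp.inner_apply,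
      Finset.sum_mul_sum, RCLike.inner_apply, conj_trivial]
    exact Finset.sum_congr rfl fun i _ => Finset.sum_congr rfl fun j _ => by ring
  eq_zero_of_forall_inner_eq_zero A hA := by
    ext i j
    rw [← frobenius_inner_vecMulVec_single A i j]
    exact hA _ _

end OuterProduct

section VanishingIntegrals

variable {E : Type*} [NormedAddCommGroup E] [NormedSpace ℝ E] [CompleteSpace E]

theorem ae_eq_zero_of_forall_setIntegral_eq_zero_of_isPiSystem {α : Type*} {C : Set (Set α)}
    [m : MeasurableSpace α] {μ : Measure α} {f : α → E} (hf : Integrable f μ)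
    (hm : m = MeasurableSpace.generateFrom C) (hC : IsPiSystem C)
    (huniv : ∫ x, f x ∂μ = 0) (h : ∀ s ∈ C, ∫ x in s, f x ∂μ = 0) : f =ᵐ[μ] 0 := by
  suffices ∀ s, MeasurableSet s → ∫ x in s, f x ∂μ = 0 from
    hf.ae_eq_zero_of_forall_setIntegral_eq_zero fun s hs _ => this s hs
  intro s hs
  induction s, hs using MeasurableSpace.induction_on_inter hm hC with
  | empty => exact setIntegral_empty
  | basic s hs => exact h s hs
  | compl s hs ih => rw [setIntegral_compl hs hf, huniv, ih, sub_zero]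
  | iUnion s hdisj hs ih =>
    simp only [integral_iUnion hs hdisj hf.integrableOn, ih, tsum_zero]

variable {α β : Type*} [MeasurableSpace α] [MeasurableSpace β]

theorem ae_eq_zero_of_forall_setIntegral_prod_eq_zero {ρ : Measure (α × β)} {f : α × β → E}
    (hf : Integrable f ρ)
    (h : ∀ s, MeasurableSet s → ∀ t, MeasurableSet t → ∫ p in s ×ˢ t, f p ∂ρ = 0) :
    f =ᵐ[ρ] 0 := by
  refine ae_eq_zero_of_forall_setIntegral_eq_zero_of_isPiSystem hf generateFrom_prod.symm
    isPiSystem_prod ?_ ?_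
  · simpa only [Set.univ_prod_univ, setIntegral_univ] using h Set.univ .univ Set.univ .univ
  · rintro _ ⟨s, hs, t, ht, rfl⟩
    exact h s hs t ht

theorem ae_eq_zero_of_forall_setIntegral_prod_eq_zero_of_sigmaFinite {μ : Measure α}
    {ν : Measure β} [SigmaFinite μ] [SigmaFinite ν] {f : α × β → E}
    (hf : ∀ s, MeasurableSet s → μ s < ⊤ → ∀ t, MeasurableSet t → ν t < ⊤ →
      IntegrableOn f (s ×ˢ t) (μ.prod ν))
    (h : ∀ s, MeasurableSet s → μ s < ⊤ → ∀ t, MeasurableSet t → ν t < ⊤ →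
      ∫ p in s ×ˢ t, f p ∂(μ.prod ν) = 0) : f =ᵐ[μ.prod ν] 0 := by
  have hunion : ⋃ n, spanningSets μ n ×ˢ spanningSets ν n = Set.univ := by
    rw [Set.iUnion_prod_of_monotone (monotone_spanningSets μ) (monotone_spanningSets ν),
      iUnion_spanningSets, iUnion_spanningSets, Set.univ_prod_univ]
  rw [← Measure.restrict_univ (μ := μ.prod ν), ← hunion, Filter.EventuallyEq,
    ae_restrict_iUnion_iff]
  intro n
  have hs := measurableSet_spanningSets μ n
  have ht := measurableSet_spanningSets ν n
  have hμs := measure_spanningSets_lt_top μ n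
  have hνt := measure_spanningSets_lt_top ν n
  refine ae_eq_zero_of_forall_setIntegral_prod_eq_zero (hf _ hs hμs _ ht hνt)
    fun s' hs' t' ht' => ?_
  rw [Measure.restrict_restrict (hs'.prod ht'), Set.prod_inter_prod]
  exact h _ (hs'.inter hs) (measure_inter_lt_top_of_right_ne_top hμs.ne)
    _ (ht'.inter ht) (measure_inter_lt_top_of_right_ne_top hνt.ne)

end VanishingIntegrals

namespace IsHilbertTensorMap

variable {α β : Type*} [MeasurableSpace α] [MeasurableSpace β] {μ : Measure α} {ν : Measure β}
  {E F G : Type*} [NormedAddCommGroup E] [InnerProductSpace ℝ E]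
  [NormedAddCommGroup F] [InnerProductSpace ℝ F] [NormedAddCommGroup G] [InnerProductSpace ℝ G]
  {B : E → F → G}

theorem memLp_prod (hB : IsHilbertTensorMap B) {f : α → E} {g : β → F}
    (hf : MemLp f 2 μ) (hg : MemLp g 2 ν) :
    MemLp (fun p : α × β => B (f p.1) (g p.2)) 2 (μ.prod ν) := by
  have hmeas : AEStronglyMeasurable (fun p : α × β => B (f p.1) (g p.2)) (μ.prod ν) :=
    hB.continuous_uncurry.comp_aestronglyMeasurable
      (hf.aestronglyMeasurable.comp_fst.prodMk hg.aestronglyMeasurable.comp_snd)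
  rw [memLp_two_iff_integrable_sq_norm hmeas]
  simp_rw [hB.norm_map, mul_pow]
  exact ((memLp_two_iff_integrable_sq_norm hf.aestronglyMeasurable).1 hf).mul_prod
    ((memLp_two_iff_integrable_sq_norm hg.aestronglyMeasurable).1 hg)

/-- The element `(x, y) ↦ B (v x) (w y)` of `L²(μ × ν; G)`. -/
noncomputable def l2Prod (hB : IsHilbertTensorMap B) (v : Lp E 2 μ) (w : Lp F 2 ν) :
    Lp G 2 (μ.prod ν) :=
  (hB.memLp_prod (Lp.memLp v) (Lp.memLp w)).toLp

theorem coeFn_l2Prod (hB : IsHilbertTensorMap B) (v : Lp E 2 μ) (w : Lp F 2 ν) :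
    hB.l2Prod v w =ᵐ[μ.prod ν] fun p => B (v p.1) (w p.2) :=
  MemLp.coeFn_toLp _

theorem inner_l2Prod [SFinite μ] [SFinite ν] (hB : IsHilbertTensorMap B) (v v' : Lp E 2 μ)
    (w w' : Lp F 2 ν) :
    inner ℝ (hB.l2Prod v w) (hB.l2Prod v' w') = inner ℝ v v' * inner ℝ w w' := by
  simp only [L2.inner_def]
  rw [← integral_prod_mul]
  refine integral_congr_ae ?_
  filter_upwards [hB.coeFn_l2Prod v w, hB.coeFn_l2Prod v' w'] with p hp hp'
  rw [hp, hp', hB.inner_map_map]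

theorem l2Prod_indicatorConstLp (hB : IsHilbertTensorMap B) {s : Set α}
    (hs : MeasurableSet s) (hμs : μ s ≠ ⊤) {t : Set β} (ht : MeasurableSet t) (hνt : ν t ≠ ⊤)
    (hst : (μ.prod ν) (s ×ˢ t) ≠ ⊤) (a : E) (b : F) :
    hB.l2Prod (indicatorConstLp 2 hs hμs a) (indicatorConstLp 2 ht hνt b) =
      indicatorConstLp 2 (hs.prod ht) hst (B a b) := by
  apply Lp.ext
  have hfst : ∀ᵐ p ∂μ.prod ν, indicatorConstLp 2 hs hμs a p.1 = s.indicator (fun _ => a) p.1 :=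
    Measure.quasiMeasurePreserving_fst.ae indicatorConstLp_coeFn
  have hsnd : ∀ᵐ p ∂μ.prod ν, indicatorConstLp 2 ht hνt b p.2 = t.indicator (fun _ => b) p.2 :=
    Measure.quasiMeasurePreserving_snd.ae indicatorConstLp_coeFn
  filter_upwards [hB.coeFn_l2Prod (indicatorConstLp 2 hs hμs a) (indicatorConstLp 2 ht hνt b),
    hfst, hsnd, indicatorConstLp_coeFn (p := 2) (hs := hs.prod ht) (hμs := hst) (c := B a b)]
    with p hp hp₁ hp₂ hp₁₂
  rw [hp, hp₁, hp₂, hp₁₂]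
  by_cases h₁ : p.1 ∈ s <;> by_cases h₂ : p.2 ∈ t <;>
    simp [Set.indicator, h₁, h₂, hB.map_zero_left, hB.map_zero_right]

theorem eq_zero_of_forall_inner_l2Prod_eq_zero [CompleteSpace G] [SigmaFinite μ] [SigmaFinite ν]
    (hB : IsHilbertTensorMap B) {f : Lp G 2 (μ.prod ν)}
    (hf : ∀ v w, inner ℝ (hB.l2Prod v w) f = 0) : f = 0 := by
  have hfin : ∀ s : Set α, μ s < ⊤ → ∀ t : Set β, ν t < ⊤ → (μ.prod ν) (s ×ˢ t) ≠ ⊤ :=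
    fun s hμs t hνt => by
      rw [Measure.prod_prod]
      exact ENNReal.mul_ne_top hμs.ne hνt.ne
  rw [Lp.eq_zero_iff_ae_eq_zero]
  refine ae_eq_zero_of_forall_setIntegral_prod_eq_zero_of_sigmaFinite (fun s _ hμs t _ hνt =>
    integrableOn_Lp_of_measure_ne_top f one_le_two (hfin s hμs t hνt)) fun s hs hμs t ht hνt => ?_
  refine hB.eq_zero_of_forall_inner_eq_zero _ fun a b => ?_
  rw [← L2.inner_indicatorConstLp_eq_inner_setIntegral ℝ (hs.prod ht) (hfin s hμs t hνt),
    ← hB.l2Prod_indicatorConstLp hs hμs.ne ht hνt.ne]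
  exact hf _ _

theorem isHilbertTensorMap_l2Prod [CompleteSpace G] [SigmaFinite μ] [SigmaFinite ν]
    (hB : IsHilbertTensorMap B) :
    IsHilbertTensorMap (hB.l2Prod : Lp E 2 μ → Lp F 2 ν → Lp G 2 (μ.prod ν)) where
  inner_map_map := hB.inner_l2Prod
  eq_zero_of_forall_inner_eq_zero _ := hB.eq_zero_of_forall_inner_l2Prod_eq_zero

end IsHilbertTensorMap

theorem proposition2_general {α β E F G : Type*} [MeasurableSpace α] [MeasurableSpace β]
    [NormedAddCommGroup E] [InnerProductSpace ℝ E] [NormedAddCommGroup F] [InnerProductSpace ℝ F]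
    [NormedAddCommGroup G] [InnerProductSpace ℝ G] [CompleteSpace G] (μ : Measure α)
    (ν : Measure β) [SigmaFinite μ] [SigmaFinite ν] {B : E → F → G} (hB : IsHilbertTensorMap B) :
    ∃ Φ : HilbertTensor (Lp E 2 μ) (Lp F 2 ν) ≃ₗᵢ[ℝ] Lp G 2 (μ.prod ν),
      ∀ v w, ∀ᵐ p ∂μ.prod ν, Φ (hilbertTmul v w) p = B (v p.1) (w p.2) := by
  refine ⟨hB.isHilbertTensorMap_l2Prod.hilbertTensorEquiv, fun v w => ?_⟩
  rw [IsHilbertTensorMap.hilbertTensorEquiv_hilbertTmul]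
  exact hB.coeFn_l2Prod v w

theorem proposition2 (d q : ℕ) (U : Set (EuclideanSpace ℝ (Fin d))) (hU : MeasurableSet U) :
    ∃ Φ : HilbertTensor (L2Vec U q) (L2Vec U q) ≃ₗᵢ[ℝ] L2Mat U q,
      ∀ v w : L2Vec U q,
        ∀ᵐ p : EuclideanSpace ℝ (Fin d) × EuclideanSpace ℝ (Fin d)
            ∂(volume.restrict (U ×ˢ U)),
          (Φ (hilbertTmul v w)) p = Matrix.vecMulVec (v p.1) (w p.2) := by
  unfold L2Mat
  rw [Measure.volume_eq_prod, ← Measure.prod_restrict]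
  exact proposition2_general _ _ isHilbertTensorMap_vecMulVec
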